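/- For an integer $m\ge 0$ let $Q_m$ be the set of all continuous functions on $[-1,1]$ of the form $p/q$, where $p,q$ are real polynomials of degree at most $m$ and $q\not\equiv 0$ (at zeros of $q$ in $[-1,1]$, if any, the value is understood by continuity). **Theorem 1.** Let $n\ge 0$ be an integer. If $R\in Q_{2n}$ is odd and increasing (in the weak sense) on $[-1,1]$, then $R$ is differentiable at $0$ and $$R'(0)\le \tfrac12\cdot 9^n\,R(1).$$ -/

import Mathlib

/-- The class `Q_m` of continuous rational functions on `[-1, 1]` of degree at most `m`: functions
continuous on `[-1, 1]` that coincide there with a quotient `p / q` of real polynomials of degree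
at most `m`, where `q` is not the zero polynomial. Zeros of `q` on `[-1, 1]` are allowed as long as
the quotient extends continuously, the value there being given by continuity. Only the values of
`R` on `[-1, 1]` matter. -/
def ratClass (m : ℕ) : Set (ℝ → ℝ) :=
  {R | ContinuousOn R (Set.Icc (-1) 1) ∧
    ∃ p q : Polynomial ℝ, p.natDegree ≤ m ∧ q.natDegree ≤ m ∧ q ≠ 0 ∧
      ∀ x ∈ Set.Icc (-1 : ℝ) 1, q.eval x ≠ 0 → R x = p.eval x / q.eval x}

/-! The proof is an induction on n with the sharper constant c_n = (9^n - 2^n)/2. In lowest terms R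
= p/q with p odd and q even, so R'(0) = p'(0)/q(0). The step from m to m + 1 splits on a threshold w
for the squared moduli of the poles.

If every pole has |b|^2 ≥ w, then |q| ≤ |q(0)| (1 + e^2/w)^(m+1) on [-e, e]. Since |p| ≤ R(1)|q|,
the odd polynomial p is bounded there, and so is its linear coefficient (`abs_coeff_one_le_of_odd`).

If some pole b is nearer, choose φ(t) = t(t^2 - u)/(κt^2 - u), for which φ'(0) = 1, so that b is a
critical point with nonreal value v₀. The sum T(v) of R over φ⁻¹(v) is a quotient of degree at most
2m + 2 whose numerator and denominator both vanish at v₀ and its conjugate, because b is double in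
its fiber; hence T has degree at most 2m. For |v| ≤ s = φ(1) the fiber has one point in each
component of [-1, 1] without the poles ±d of φ, and these points increase with v. So T is odd and
increasing, T(s) ≤ R(1) and T'(0) ≥ R'(0). Induction applied to T(sx) gives s R'(0) ≤ c_m R(1),
where 1/s ≤ (9 - 3|b|^2)/(1 - 3|b|^2) (`slope_le_of_pole_near`). Subtracting 2^n makes c_{m+1} > 9
c_m, which leaves room for w > 0. -/

open Polynomial

/-! ### Reduced fractions and parity -/

/-- A function of class `Q_m` is a reduced fraction whose denominator has no zero on `[-1, 1]`. -/
theorem exists_coprime_of_mem_ratClass {m : ℕ} {R : ℝ → ℝ} (hR : R ∈ ratClass m) :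
    ∃ p q : ℝ[X], p.natDegree ≤ m ∧ q.natDegree ≤ m ∧ IsCoprime p q ∧
      ∀ x ∈ Set.Icc (-1 : ℝ) 1, q.eval x ≠ 0 ∧ R x = p.eval x / q.eval x := by
  obtain ⟨hc, p₀, q₀, hp₀, hq₀, hne, hRpq⟩ := hR
  set g := gcd p₀ q₀ with hg
  obtain ⟨p, hp⟩ : g ∣ p₀ := gcd_dvd_left p₀ q₀
  obtain ⟨q, hq⟩ : g ∣ q₀ := gcd_dvd_right p₀ q₀
  have hg0 : g ≠ 0 := by
    rintro h
    rw [h, zero_mul] at hq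
    exact hne hq
  have hq0 : q ≠ 0 := by
    rintro rfl
    rw [mul_zero] at hq
    exact hne hq
  have hcop : IsCoprime p q := by
    have h := isCoprime_div_gcd_div_gcd (p := p₀) hne
    rw [← hg] at h
    rwa [show p₀ / g = p by conv_lhs => rw [hp]
                            exact mul_div_cancel_left₀ p hg0,
      show q₀ / g = q by conv_lhs => rw [hq]
                         exact mul_div_cancel_left₀ q hg0] at h
  have hpd : p.natDegree ≤ m := by
    by_cases h0 : p = 0
    · simp [h0]
    · have := natDegree_mul hg0 h0
      rw [← hp] at this
      omega
  have hqd : q.natDegree ≤ m := by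
    have := natDegree_mul hg0 hq0
    rw [← hq] at this
    omega
  have hEq : Set.EqOn (fun x => R x * q.eval x) (fun x => p.eval x) (Set.Icc (-1) 1) := by
    refine Set.EqOn.of_subset_closure (s := Set.Ioo (-1 : ℝ) 1 ∩ {x | q₀.IsRoot x}ᶜ) ?_
      (hc.mul q.continuous.continuousOn) p.continuous.continuousOn
      (fun x hx => Set.Ioo_subset_Icc_self hx.1) ?_
    · rintro x ⟨hx, hx0⟩
      have hx0' : q₀.eval x ≠ 0 := hx0
      have h1 := hRpq x (Set.Ioo_subset_Icc_self hx) hx0'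
      rw [hq, eval_mul] at hx0'
      rw [hp, hq, eval_mul, eval_mul, mul_div_mul_left _ _ (left_ne_zero_of_mul hx0')] at h1
      have := right_ne_zero_of_mul hx0'
      simp only [h1]
      field_simp
    · have hd : Dense {x | q₀.IsRoot x}ᶜ :=
        (Polynomial.finite_setOfPred_isRoot hne).countable.dense_compl ℝ
      have := closure_mono (hd.open_subset_closure_inter (isOpen_Ioo (a := (-1 : ℝ)) (b := 1)))
      rwa [closure_closure, closure_Ioo (by norm_num)] at this
  refine ⟨p, q, hpd, hqd, hcop, fun x hx => ?_⟩
  have h := hEq hx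
  simp only at h
  -- A zero of `q` would be a zero of `p` too, against Bézout.
  have hqx : q.eval x ≠ 0 := by
    intro h0
    rw [h0, mul_zero] at h
    obtain ⟨a, b, hab⟩ := hcop
    have := congrArg (Polynomial.eval x) hab
    simp [h0, ← h] at this
  exact ⟨hqx, by rw [← h]; field_simp⟩

/-- If a reduced fraction with nonvanishing denominator is odd on `[-1, 1]`, its numerator is odd
and its denominator even. -/
theorem parity_of_odd_on {p q : ℝ[X]} (hpq : IsCoprime p q)
    (hq : ∀ x ∈ Set.Icc (-1 : ℝ) 1, q.eval x ≠ 0)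
    (hodd : ∀ x ∈ Set.Icc (-1 : ℝ) 1, p.eval (-x) / q.eval (-x) = -(p.eval x / q.eval x)) :
    (∀ x, p.eval (-x) = -p.eval x) ∧ ∀ x, q.eval (-x) = q.eval x := by
  have hinf : (Set.Icc (-1 : ℝ) 1).Infinite := Set.Icc_infinite (by norm_num)
  have hid : q.comp (-X) * p = -(p.comp (-X) * q) := by
    refine eq_of_infinite_eval_eq _ _ (hinf.mono fun x hx => ?_)
    have h1 := hq x hx
    have h2 := hq (-x) ⟨by linarith [hx.2], by linarith [hx.1]⟩
    have h3 := hodd x hx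
    rw [← neg_div, div_eq_div_iff h2 h1] at h3
    simp only [Set.mem_ofPred_eq, eval_mul, eval_comp, eval_neg, eval_X]
    linarith
  have hq0 : q.eval 0 ≠ 0 := hq 0 (by norm_num)
  have hqne : q ≠ 0 := by
    rintro rfl
    simp at hq0
  have hdvd : q ∣ q.comp (-X) := by
    refine hpq.symm.dvd_of_dvd_mul_right ?_
    rw [hid]
    exact (Dvd.intro_left _ rfl).neg_right
  obtain ⟨r, hr⟩ := hdvd
  have hcompne : q.comp (-X) ≠ 0 := by
    intro h
    have := congrArg (Polynomial.eval 0) h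
    simp [eval_comp, hq0] at this
  have hrne : r ≠ 0 := by
    rintro rfl
    rw [mul_zero] at hr
    exact hcompne hr
  -- Reflection preserves the degree, so the cofactor is constant; comparison at 0 makes it 1.
  have hrd : r.natDegree = 0 := by
    have h1 := natDegree_mul hqne hrne
    rw [← hr, natDegree_comp, natDegree_neg, natDegree_X, mul_one] at h1
    omega
  rw [eq_C_of_natDegree_eq_zero hrd] at hr
  have hr1 : r.coeff 0 = 1 := by
    have := congrArg (Polynomial.eval 0) hr
    simp only [eval_comp, eval_neg, eval_X, neg_zero, eval_mul, eval_C] at this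
    exact mul_left_cancel₀ hq0 (by rw [← this, mul_one])
  rw [hr1, C_1, mul_one] at hr
  have hp : p.comp (-X) = -p := by
    rw [hr] at hid
    refine mul_right_cancel₀ hqne ?_
    linear_combination hid
  refine ⟨fun x => ?_, fun x => ?_⟩
  · simpa [eval_comp] using congrArg (Polynomial.eval x) hp
  · simpa [eval_comp] using congrArg (Polynomial.eval x) hr

/-! ### Odd polynomials bounded on [-1, 1] -/

theorem coeff_eq_zero_of_odd {p : ℝ[X]} (hp : ∀ x, p.eval (-x) = -p.eval x) {k : ℕ}
    (hk : Even k) : p.coeff k = 0 := by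
  have h : p.comp (C (-1) * X) = -p := by
    refine Polynomial.funext fun x => ?_
    simp [eval_comp, hp]
  have := congrArg (fun f => coeff f k) h
  simp only [comp_C_mul_X_coeff, hk.neg_one_pow, coeff_neg] at this
  linarith

theorem natDegree_le_of_odd {p : ℝ[X]} (hp : ∀ x, p.eval (-x) = -p.eval x) {m : ℕ}
    (hd : p.natDegree ≤ 2 * (m + 1)) : p.natDegree ≤ 2 * m + 1 := by
  rw [natDegree_le_iff_coeff_eq_zero] at hd ⊢
  intro N hN
  rcases eq_or_ne N (2 * (m + 1)) with rfl | h
  · exact coeff_eq_zero_of_odd hp (even_two_mul _)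
  · exact hd N (by omega)

/-- The linear coefficient of an odd polynomial, bounded by its maximum on `[-1, 1]`. -/
theorem abs_coeff_one_le_of_odd (m : ℕ) : ∀ {p : ℝ[X]} {M : ℝ},
    (∀ x, p.eval (-x) = -p.eval x) → p.natDegree ≤ 2 * m + 1 →
    (∀ x ∈ Set.Icc (-1 : ℝ) 1, |p.eval x| ≤ M) → |p.coeff 1| ≤ 3 ^ m * M := by
  induction m with
  | zero =>
    intro p M hodd hd hM
    have h0 : p.coeff 0 = 0 := coeff_eq_zero_of_odd hodd (by simp)
    have h1 := hM 1 (by norm_num)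
    rw [eq_X_add_C_of_natDegree_le_one (p := p) (by simpa using hd)] at h1
    simpa [h0] using h1
  | succ m ih =>
    intro p M hodd hd hM
    set a : ℝ := 4 ^ (m + 1) with ha
    have ha4 : 4 ≤ a := by
      rw [ha, pow_succ]
      have : (1 : ℝ) ≤ 4 ^ m := one_le_pow₀ (by norm_num)
      linarith
    -- Richardson extrapolation: the factor 2a cancels the coefficient of degree 2m + 3 and
    -- multiplies the linear one by a - 1.
    set r : ℝ[X] := C (2 * a) * p.comp (C (1 / 2) * X) - p with hr
    have hre : ∀ x, r.eval x = 2 * a * p.eval (1 / 2 * x) - p.eval x := by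
      intro x
      simp [hr, eval_comp]
    have hrc : ∀ k, r.coeff k = (2 * a * (1 / 2) ^ k - 1) * p.coeff k := by
      intro k
      simp only [hr, coeff_sub, coeff_C_mul, comp_C_mul_X_coeff]
      ring
    have hrodd : ∀ x, r.eval (-x) = -r.eval x := by
      intro x
      rw [hre, hre, mul_neg, hodd, hodd]
      ring
    have hrd : r.natDegree ≤ 2 * m + 1 := by
      refine natDegree_le_of_odd hrodd ?_
      rw [natDegree_le_iff_coeff_eq_zero] at hd ⊢
      intro N hN
      rcases eq_or_ne N (2 * (m + 1) + 1) with rfl | h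
      · rw [hrc, ha, pow_succ (1 / 2 : ℝ), pow_mul]
        have : (4 : ℝ) ^ (m + 1) * ((1 / 2) ^ 2) ^ (m + 1) = 1 := by
          rw [← mul_pow]; norm_num
        linear_combination (p.coeff (2 * (m + 1) + 1)) * this
      · rw [hrc, hd N (by omega), mul_zero]
    have hrM : ∀ x ∈ Set.Icc (-1 : ℝ) 1, |r.eval x| ≤ (2 * a + 1) * M := by
      intro x hx
      have h1 := hM x hx
      have h2 := hM (1 / 2 * x) ⟨by linarith [hx.1], by linarith [hx.2]⟩
      rw [hre, abs_le] at *
      constructor <;> nlinarith [h1.1, h1.2, h2.1, h2.2]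
    have h := ih hrodd hrd hrM
    have hM0 : 0 ≤ M := (abs_nonneg _).trans (hM 0 (by norm_num))
    rw [hrc, abs_mul, pow_one, abs_of_nonneg (by linarith : 0 ≤ 2 * a * (1 / 2) - 1)] at h
    have h3 : (0 : ℝ) ≤ 3 ^ m * M := by positivity
    rw [pow_succ]
    -- The loss per step is (2a + 1)/(a - 1), at most 3 because a ≥ 4.
    refine le_of_mul_le_mul_left (h.trans ?_) (by linarith : 0 < 2 * a * (1 / 2) - 1)
    nlinarith [mul_nonneg h3 (sub_nonneg.2 ha4)]

/-! ### Far poles: growth of the denominator and slope bound -/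

/-- Pairing x with -x turns each root's contribution into |b^2 - x^2|, and w ≤ |b|^2 absorbs x^2. -/
theorem norm_prod_sub_mul_norm_prod_add_le {w x : ℝ} (hw : 0 < w) (s : Multiset ℂ)
    (hs : ∀ b ∈ s, w ≤ ‖b‖ ^ 2) :
    ‖(s.map fun b => (x : ℂ) - b).prod‖ * ‖(s.map fun b => -(x : ℂ) - b).prod‖ ≤
      ‖(s.map fun b => 0 - b).prod‖ ^ 2 * (1 + x ^ 2 / w) ^ Multiset.card s := by
  induction s using Multiset.induction_on with
  | empty => simp
  | cons b s ih =>
    have ih := ih fun c hc => hs c (Multiset.mem_cons_of_mem hc)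
    have hb := hs b (Multiset.mem_cons_self b s)
    have h1 : ‖(x : ℂ) - b‖ * ‖-(x : ℂ) - b‖ ≤ ‖0 - b‖ ^ 2 * (1 + x ^ 2 / w) := by
      rw [← norm_mul, show ((x : ℂ) - b) * (-(x : ℂ) - b) = b ^ 2 - (x : ℂ) ^ 2 by ring, zero_sub,
        norm_neg]
      refine (norm_sub_le _ _).trans ?_
      rw [norm_pow, norm_pow, Complex.norm_real, Real.norm_eq_abs, sq_abs, mul_add, mul_one]
      gcongr
      rw [mul_div_assoc', le_div_iff₀ hw]
      nlinarith [mul_le_mul_of_nonneg_left hb (sq_nonneg x)]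
    simp only [Multiset.map_cons, Multiset.prod_cons, norm_mul, Multiset.card_cons, pow_succ _ s.card]
    calc _ = (‖(x : ℂ) - b‖ * ‖-(x : ℂ) - b‖) * (‖(s.map fun b => (x : ℂ) - b).prod‖ *
          ‖(s.map fun b => -(x : ℂ) - b).prod‖) := by ring
      _ ≤ (‖0 - b‖ ^ 2 * (1 + x ^ 2 / w)) * (‖(s.map fun b => 0 - b).prod‖ ^ 2 *
          (1 + x ^ 2 / w) ^ Multiset.card s) := by gcongr
      _ = _ := by ring

/-- Growth of an even polynomial whose complex roots stay away from the origin. -/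
theorem abs_eval_le_of_even {q : ℝ[X]} (hq : ∀ x, q.eval (-x) = q.eval x) {n : ℕ}
    (hd : q.natDegree ≤ 2 * n) {w : ℝ} (hw : 0 < w)
    (hroots : ∀ b : ℂ, aeval b q = 0 → w ≤ ‖b‖ ^ 2) (x : ℝ) :
    |q.eval x| ≤ |q.eval 0| * (1 + x ^ 2 / w) ^ n := by
  rcases eq_or_ne q 0 with rfl | hq0
  · simp
  set Q : ℂ[X] := q.map (algebraMap ℝ ℂ) with hQ
  have hQ0 : Q ≠ 0 := by rwa [hQ, Ne, Polynomial.map_eq_zero]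
  have hev : ∀ y : ℝ, |q.eval y| = ‖Q.leadingCoeff‖ * ‖(Q.roots.map fun b => (y : ℂ) - b).prod‖ := by
    intro y
    rw [← norm_mul, ← (IsAlgClosed.splits Q).eval_eq_prod_roots, ← Real.norm_eq_abs,
      ← Complex.norm_real]
    congr 1
    rw [hQ]
    exact (Polynomial.eval_map_apply (f := algebraMap ℝ ℂ) (p := q) y).symm
  have hmem : ∀ b ∈ Q.roots, w ≤ ‖b‖ ^ 2 := by
    intro b hb
    refine hroots b ?_
    rw [aeval_def, ← eval_map]
    exact (mem_roots hQ0).1 hb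
  have hcard : Multiset.card Q.roots ≤ 2 * n :=
    (card_roots' Q).trans ((natDegree_map_le).trans hd)
  have hone : 1 ≤ 1 + x ^ 2 / w := by
    have : 0 ≤ x ^ 2 / w := by positivity
    linarith
  have key : |q.eval x| * |q.eval (-x)| ≤ |q.eval 0| ^ 2 * (1 + x ^ 2 / w) ^ (2 * n) := by
    have h := norm_prod_sub_mul_norm_prod_add_le (x := x) hw Q.roots hmem
    rw [hev x, hev (-x), hev 0]
    push_cast
    calc _ = ‖Q.leadingCoeff‖ ^ 2 * (‖(Q.roots.map fun b => (x : ℂ) - b).prod‖ *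
          ‖(Q.roots.map fun b => -(x : ℂ) - b).prod‖) := by ring
      _ ≤ ‖Q.leadingCoeff‖ ^ 2 * (‖(Q.roots.map fun b => 0 - b).prod‖ ^ 2 *
          (1 + x ^ 2 / w) ^ (2 * n)) := by
        refine mul_le_mul_of_nonneg_left (h.trans ?_) (by positivity)
        exact mul_le_mul_of_nonneg_left (pow_le_pow_right₀ hone hcard) (by positivity)
      _ = _ := by ring
  -- Evenness makes the left side a square; the root halves the exponent 2n.
  rw [hq, ← sq, pow_mul', ← mul_pow] at key
  exact le_of_sq_le_sq key (by positivity)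

theorem hasDerivAt_zero_of_odd_div_even {p q : ℝ[X]} {R : ℝ → ℝ} (hp : ∀ x, p.eval (-x) = -p.eval x)
    (hq0 : q.eval 0 ≠ 0)
    (hR : ∀ x ∈ Set.Icc (-1 : ℝ) 1, R x = p.eval x / q.eval x) :
    HasDerivAt R (p.coeff 1 / q.eval 0) 0 := by
  have hp0 : p.eval 0 = 0 := by
    have := hp 0
    rw [neg_zero] at this
    linarith
  have h := (p.hasDerivAt 0).div (q.hasDerivAt 0) hq0
  have hp1 : p.derivative.eval 0 = p.coeff 1 := by
    rw [← coeff_zero_eq_eval_zero, coeff_derivative]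
    simp
  rw [hp0, hp1, zero_mul, sub_zero, sq, mul_div_mul_right _ _ hq0] at h
  refine h.congr_of_eventuallyEq ?_
  filter_upwards [Icc_mem_nhds (show (-1 : ℝ) < 0 by norm_num) (show (0 : ℝ) < 1 by norm_num)]
    with x hx
  exact hR x hx

/-- Slope bound at the origin when all poles are far away. -/
theorem abs_coeff_one_le_of_roots_far {p q : ℝ[X]} {m : ℕ} {M w e : ℝ}
    (hp : ∀ x, p.eval (-x) = -p.eval x) (hpd : p.natDegree ≤ 2 * (m + 1))
    (hq : ∀ x, q.eval (-x) = q.eval x) (hqd : q.natDegree ≤ 2 * (m + 1))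
    (hw : 0 < w) (hroots : ∀ b : ℂ, aeval b q = 0 → w ≤ ‖b‖ ^ 2) (he : 0 < e) (he1 : e ≤ 1)
    (hM : ∀ x ∈ Set.Icc (-1 : ℝ) 1, |p.eval x| ≤ M * |q.eval x|) (hM0 : 0 ≤ M) :
    e * |p.coeff 1| ≤ 3 ^ m * (1 + e ^ 2 / w) ^ (m + 1) * (M * |q.eval 0|) := by
  have h := abs_coeff_one_le_of_odd m (p := p.comp (C e * X))
    (M := M * (|q.eval 0| * (1 + e ^ 2 / w) ^ (m + 1))) ?_ ?_ ?_
  · rw [comp_C_mul_X_coeff, pow_one, abs_mul, abs_of_pos he] at h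
    calc _ = |p.coeff 1| * e := mul_comm _ _
      _ ≤ _ := h
      _ = _ := by ring
  · intro x
    simp only [eval_comp, eval_mul, eval_C, eval_X, mul_neg, hp]
  · rw [natDegree_comp, natDegree_C_mul_X _ he.ne', mul_one]
    exact natDegree_le_of_odd hp hpd
  · intro x hx
    have hex : e * x ∈ Set.Icc (-1 : ℝ) 1 := by
      constructor <;> nlinarith [hx.1, hx.2]
    simp only [eval_comp, eval_mul, eval_C, eval_X]
    refine (hM _ hex).trans (mul_le_mul_of_nonneg_left ?_ hM0)
    refine (abs_eval_le_of_even hq hqd hw hroots _).trans ?_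
    have hx2 : x ^ 2 ≤ 1 := by nlinarith [hx.1, hx.2]
    rw [mul_pow]
    have : e ^ 2 * x ^ 2 ≤ e ^ 2 := by nlinarith [sq_nonneg e]
    gcongr

/-! ### Norms and traces along the fibers of the cubic map -/

/-- `x, y, z` are the three preimages of `v` under `X (X ^ 2 - u) / (κ X ^ 2 - u)`. -/
def IsFiber {F : Type*} [CommRing F] (κ u v x y z : F) : Prop :=
  x + y + z = κ * v ∧ x * y + x * z + y * z = -u ∧ x * y * z = -(u * v)

theorem IsFiber.ofReal {κ u v x y z : ℝ} (h : IsFiber κ u v x y z) :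
    IsFiber (κ : ℂ) u v x y z := by
  obtain ⟨h1, h2, h3⟩ := h
  refine ⟨?_, ?_, ?_⟩
  · exact_mod_cast h1
  · exact_mod_cast h2
  · exact_mod_cast h3

/-- The product of the values of a polynomial over the fiber above `v` is a polynomial in `v`. -/
theorem exists_fiber_norm_complex (f : ℂ[X]) (κ u : ℂ) :
    ∃ F : ℂ[X], F.natDegree ≤ f.natDegree ∧ ∀ v x y z, IsFiber κ u v x y z →
      F.eval v = f.eval x * f.eval y * f.eval z := by
  refine ⟨C (f.leadingCoeff ^ 3) *
    (f.roots.map fun b => C (κ * b ^ 2 - u) * X - C (b ^ 3 - u * b)).prod, ?_, ?_⟩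
  · refine (natDegree_C_mul_le _ _).trans ((natDegree_multiset_prod_le _).trans ?_)
    rw [Multiset.map_map]
    refine (Multiset.sum_le_card_nsmul _ 1 ?_).trans ?_
    · intro d hd
      obtain ⟨b, -, rfl⟩ := Multiset.mem_map.1 hd
      simp only [Function.comp]
      compute_degree
    · simpa using card_roots' f
  · rintro v x y z ⟨h1, h2, h3⟩
    have hf := fun a => (IsAlgClosed.splits f).eval_eq_prod_roots a
    rw [hf x, hf y, hf z, eval_mul, eval_C, eval_multiset_prod, Multiset.map_map]
    -- The product (x - b)(y - b)(z - b) is, up to sign, the fiber cubic at b, hence affine in v: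
    -- each root of `f` costs one degree.
    have : (f.roots.map (eval v ∘ fun b => C (κ * b ^ 2 - u) * X - C (b ^ 3 - u * b))).prod =
        (f.roots.map fun b => x - b).prod * (f.roots.map fun b => y - b).prod *
          (f.roots.map fun b => z - b).prod := by
      rw [← Multiset.prod_map_mul, ← Multiset.prod_map_mul]
      congr 1
      refine Multiset.map_congr rfl fun b _ => ?_
      simp only [Function.comp, eval_sub, eval_mul, eval_C, eval_X]
      linear_combination -b ^ 2 * h1 + b * h2 - h3
    rw [this]
    ring

/-- `F` and its conjugate agree at infinitely many real points, so the coefficients are real. -/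
theorem exists_real_map_eq {F : ℂ[X]}
    (hF : {v : ℝ | ∃ r : ℝ, F.eval (v : ℂ) = r}.Infinite) :
    ∃ G : ℝ[X], G.map (algebraMap ℝ ℂ) = F := by
  have hconj : F.map (starRingEnd ℂ) = F := by
    refine eq_of_infinite_eval_eq _ _
      ((hF.image Complex.ofReal_injective.injOn).mono ?_)
    rintro _ ⟨v, ⟨r, hr⟩, rfl⟩
    have h := Polynomial.eval_map_apply (f := starRingEnd ℂ) (p := F) (v : ℂ)
    rw [Complex.conj_ofReal, hr, Complex.conj_ofReal] at h
    exact h.trans hr.symm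
  refine (mem_lifts F).1 ((lifts_iff_coeff_lifts F).2 fun k => ?_)
  have h := congrArg (fun f => coeff f k) hconj
  simp only [coeff_map] at h
  exact ⟨(F.coeff k).re, Complex.conj_eq_iff_re.1 h⟩

theorem exists_fiber_norm {κ u : ℝ}
    (hinf : {v : ℝ | ∃ x y z : ℝ, IsFiber κ u v x y z}.Infinite) (f : ℝ[X]) :
    ∃ F : ℝ[X], F.natDegree ≤ f.natDegree ∧ ∀ v x y z : ℂ, IsFiber (κ : ℂ) u v x y z →
      aeval v F = aeval x f * aeval y f * aeval z f := by
  obtain ⟨F, hFd, hF⟩ := exists_fiber_norm_complex (f.map (algebraMap ℝ ℂ)) κ u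
  obtain ⟨G, hG⟩ : ∃ G : ℝ[X], G.map (algebraMap ℝ ℂ) = F := by
    refine exists_real_map_eq (hinf.mono ?_)
    rintro v ⟨x, y, z, h⟩
    refine ⟨f.eval x * f.eval y * f.eval z, ?_⟩
    rw [hF _ _ _ _ h.ofReal]
    have he := fun a : ℝ => Polynomial.eval_map_apply (f := algebraMap ℝ ℂ) (p := f) a
    simp only [Complex.coe_algebraMap] at he
    simp only [he]
    push_cast
    ring
  refine ⟨G, ?_, fun v x y z h => ?_⟩
  · rw [← natDegree_map (algebraMap ℝ ℂ) (p := G), hG]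
    exact hFd.trans natDegree_map_le
  · have := hF v x y z h
    rw [← hG] at this
    simpa only [eval_map_algebraMap] using this

/-- The trace is the coefficient of c in the fiber norm of q + cp, which is cubic in c. -/
theorem exists_fiber_trace {κ u : ℝ}
    (hinf : {v : ℝ | ∃ x y z : ℝ, IsFiber κ u v x y z}.Infinite) {p q : ℝ[X]} {d : ℕ}
    (hp : p.natDegree ≤ d) (hq : q.natDegree ≤ d) :
    ∃ F : ℝ[X], F.natDegree ≤ d ∧ ∀ v x y z : ℂ, IsFiber (κ : ℂ) u v x y z →
      aeval v F = aeval x p * aeval y q * aeval z q + aeval x q * aeval y p * aeval z q +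
        aeval x q * aeval y q * aeval z p := by
  have key : ∀ c : ℝ, ∃ F : ℝ[X], F.natDegree ≤ d ∧ ∀ v x y z : ℂ, IsFiber (κ : ℂ) u v x y z →
      aeval v F = (aeval x q + c * aeval x p) * (aeval y q + c * aeval y p) *
        (aeval z q + c * aeval z p) := by
    intro c
    obtain ⟨F, h1, h2⟩ := exists_fiber_norm hinf (q + C c * p)
    refine ⟨F, h1.trans (natDegree_add_le_of_degree_le hq ((natDegree_C_mul_le _ _).trans hp)), ?_⟩
    intro v x y z h
    simpa using h2 v x y z h
  obtain ⟨F₁, hd₁, h₁⟩ := key 1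
  obtain ⟨F₂, hd₂, h₂⟩ := key (-1)
  obtain ⟨F₃, hd₃, h₃⟩ := key 2
  obtain ⟨F₄, hd₄, h₄⟩ := key (-2)
  -- Differences at c = ±1 and ±2 isolate the linear coefficient of a cubic; these weights cancel
  -- the c^3 term.
  refine ⟨C (2 / 3) * (F₁ - F₂) - C (1 / 12) * (F₃ - F₄), ?_, fun v x y z h => ?_⟩
  · simpa using natDegree_sub_le_of_le ((natDegree_C_mul_le _ _).trans (natDegree_sub_le_of_le hd₁ hd₂))
      ((natDegree_C_mul_le _ _).trans (natDegree_sub_le_of_le hd₃ hd₄))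
  · simp only [map_sub, map_mul, aeval_C, h₁ v x y z h, h₂ v x y z h, h₃ v x y z h, h₄ v x y z h,
      Complex.coe_algebraMap]
    push_cast
    ring

/-- Summing `p / q` over the fibers lowers the degree by two if a zero of `q` is a critical point
with nonreal critical value. -/
theorem exists_fiber_sum_reduced {κ u : ℝ}
    (hinf : {v : ℝ | ∃ x y z : ℝ, IsFiber κ u v x y z}.Infinite) {p q : ℝ[X]} {m : ℕ}
    (hp : p.natDegree ≤ 2 * (m + 1)) (hq : q.natDegree ≤ 2 * (m + 1)) {b y v₀ : ℂ}
    (hb : aeval b q = 0) (hfib : IsFiber (κ : ℂ) u v₀ b b y) (hv₀ : v₀.im ≠ 0)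
    (hne : ∃ v x y z : ℝ, IsFiber κ u v x y z ∧ q.eval x ≠ 0 ∧ q.eval y ≠ 0 ∧ q.eval z ≠ 0) :
    ∃ P Q : ℝ[X], P.natDegree ≤ 2 * m ∧ Q.natDegree ≤ 2 * m ∧ Q ≠ 0 ∧
      ∀ v x y z : ℝ, IsFiber κ u v x y z → q.eval x ≠ 0 → q.eval y ≠ 0 → q.eval z ≠ 0 →
        Q.eval v ≠ 0 ∧ p.eval x / q.eval x + p.eval y / q.eval y + p.eval z / q.eval z =
          P.eval v / Q.eval v := by
  obtain ⟨N, hNd, hN⟩ := exists_fiber_trace hinf hp hq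
  obtain ⟨D, hDd, hD⟩ := exists_fiber_norm hinf q
  have hcast : ∀ (f : ℝ[X]) (a : ℝ), aeval (a : ℂ) f = ((f.eval a : ℝ) : ℂ) := by
    intro f a
    simpa using aeval_algebraMap_apply_eq_algebraMap_eval (A := ℂ) a f
  have hN' : ∀ v x y z : ℝ, IsFiber κ u v x y z → N.eval v = p.eval x * q.eval y * q.eval z +
      q.eval x * p.eval y * q.eval z + q.eval x * q.eval y * p.eval z := by
    intro v x y z h
    have := hN _ _ _ _ h.ofReal
    simp only [hcast] at this
    exact_mod_cast this
  have hD' : ∀ v x y z : ℝ, IsFiber κ u v x y z → D.eval v = q.eval x * q.eval y * q.eval z := by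
    intro v x y z h
    have := hD _ _ _ _ h.ofReal
    simp only [hcast] at this
    exact_mod_cast this
  -- With b double in the fiber, every term of the trace keeps a factor q(b) = 0, so the same real
  -- quadratic divides both `N` and `D`.
  obtain ⟨P, hP⟩ := quadratic_dvd_of_aeval_eq_zero_im_ne_zero N
    (by rw [hN _ _ _ _ hfib, hb]; ring) hv₀
  obtain ⟨Q, hQ⟩ := quadratic_dvd_of_aeval_eq_zero_im_ne_zero D
    (by rw [hD _ _ _ _ hfib, hb]; ring) hv₀
  set T : ℝ[X] := X ^ 2 - C (2 * v₀.re) * X + C (‖v₀‖ ^ 2) with hT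
  have hTd : T.natDegree = 2 := by
    rw [hT]
    compute_degree!
  have hT0 : T ≠ 0 := by
    rintro h
    rw [h] at hTd
    simp at hTd
  have hdeg : ∀ f g : ℝ[X], f.natDegree ≤ 2 * (m + 1) → f = T * g → g.natDegree ≤ 2 * m := by
    intro f g hf hfg
    rcases eq_or_ne g 0 with rfl | hg
    · simp
    · have := natDegree_mul hT0 hg
      rw [← hfg, hTd] at this
      omega
  have hDne : ∀ v x y z : ℝ, IsFiber κ u v x y z → q.eval x ≠ 0 → q.eval y ≠ 0 → q.eval z ≠ 0 →
      T.eval v ≠ 0 ∧ Q.eval v ≠ 0 := by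
    intro v x y z h hx hy hz
    have h1 := hD' v x y z h
    have h2 : D.eval v ≠ 0 := by
      rw [h1]
      exact mul_ne_zero (mul_ne_zero hx hy) hz
    rw [hQ, eval_mul] at h2
    exact ⟨left_ne_zero_of_mul h2, right_ne_zero_of_mul h2⟩
  refine ⟨P, Q, hdeg N P hNd hP, hdeg D Q (hDd.trans hq) hQ, ?_, ?_⟩
  · obtain ⟨v, x, y, z, h, hx, hy, hz⟩ := hne
    rintro rfl
    simpa using (hDne v x y z h hx hy hz).2
  · intro v x y z h hx hy hz
    obtain ⟨hTv, hQv⟩ := hDne v x y z h hx hy hz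
    refine ⟨hQv, ?_⟩
    have h1 := hN' v x y z h
    have h2 := hD' v x y z h
    rw [hP, eval_mul] at h1
    rw [hQ, eval_mul] at h2
    rw [← mul_div_mul_left (P.eval v) _ hTv, h1, h2]
    field_simp

/-! ### Real fibers and their monotonicity -/

theorem IsFiber.cubic_eq {F : Type*} [CommRing F] {κ u v x y z : F} (h : IsFiber κ u v x y z)
    (t : F) : (t - x) * (t - y) * (t - z) = t * (t ^ 2 - u) - v * (κ * t ^ 2 - u) := by
  obtain ⟨h1, h2, h3⟩ := h
  linear_combination -t ^ 2 * h1 + t * h2 - h3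

/-- A real fiber in `[-1, 1]`, one point in each of the components cut out by `±d`. -/
structure IsRealFiber (κ u d v x y z : ℝ) : Prop where
  fiber : IsFiber κ u v x y z
  left_ge : -1 ≤ x
  left_lt : x < -d
  mid_gt : -d < y
  mid_lt : y < d
  right_gt : d < z
  right_le : z ≤ 1

/-- At ±d the term in v drops out of the cubic, so its signs there are fixed; the range of v
controls the signs at ±1. The intermediate value theorem gives one root in each of three intervals.
-/
theorem exists_isRealFiber {κ u d v : ℝ} (hκ : 1 < κ) (hu : 0 < u) (hu1 : u < 1) (hd : 0 < d)
    (hdκ : κ * d ^ 2 = u) (hv : v ∈ Set.Icc (-((1 - u) / (κ - u))) ((1 - u) / (κ - u))) :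
    ∃ x y z, IsRealFiber κ u d v x y z := by
  set f : ℝ → ℝ := fun t => t * (t ^ 2 - u) - v * (κ * t ^ 2 - u) with hf
  have hfc : Continuous f := by fun_prop
  have hκu : 0 < κ - u := by linarith
  have hd2 : d ^ 2 < u := by nlinarith [sq_pos_of_pos hd]
  have hd1 : d < 1 := by nlinarith
  have hfd : f d < 0 := by
    simp only [hf, hdκ]
    nlinarith
  have hfd' : 0 < f (-d) := by
    simp only [hf, neg_sq, hdκ]
    nlinarith
  have hf1 : 0 ≤ f 1 := by
    have := hv.2
    rw [le_div_iff₀ hκu] at this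
    simp only [hf]
    linarith
  have hf1' : f (-1) ≤ 0 := by
    have := hv.1
    rw [← neg_div, div_le_iff₀ hκu] at this
    simp only [hf]
    linarith
  obtain ⟨x, hx, hx0⟩ := intermediate_value_Icc (by linarith : -1 ≤ -d) hfc.continuousOn
    (show (0 : ℝ) ∈ Set.Icc (f (-1)) (f (-d)) from ⟨hf1', hfd'.le⟩)
  obtain ⟨y, hy, hy0⟩ := intermediate_value_Icc' (by linarith : -d ≤ d) hfc.continuousOn
    (show (0 : ℝ) ∈ Set.Icc (f d) (f (-d)) from ⟨hfd.le, hfd'.le⟩)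
  obtain ⟨z, hz, hz0⟩ := intermediate_value_Icc hd1.le hfc.continuousOn
    (show (0 : ℝ) ∈ Set.Icc (f d) (f 1) from ⟨hfd.le, hf1⟩)
  have hxd : x < -d := lt_of_le_of_ne hx.2 (by rintro rfl; linarith)
  have hyd : -d < y := lt_of_le_of_ne hy.1 (by rintro rfl; linarith)
  have hyd' : y < d := lt_of_le_of_ne hy.2 (by rintro rfl; linarith)
  have hzd : d < z := lt_of_le_of_ne hz.1 (by rintro rfl; linarith)
  simp only [hf] at hx0 hy0 hz0
  -- Divided differences of the cubic at its distinct roots recover Vieta's relations.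
  have h12 : x ^ 2 + x * y + y ^ 2 - u - v * κ * (x + y) = 0 :=
    mul_left_cancel₀ (show x - y ≠ 0 by linarith) (by linear_combination hx0 - hy0)
  have h13 : x ^ 2 + x * z + z ^ 2 - u - v * κ * (x + z) = 0 :=
    mul_left_cancel₀ (show x - z ≠ 0 by linarith) (by linear_combination hx0 - hz0)
  have h1 : x + y + z - κ * v = 0 :=
    mul_left_cancel₀ (show y - z ≠ 0 by linarith) (by linear_combination h12 - h13)
  have h2 : x * y + x * z + y * z = -u := by linear_combination (x + y) * h1 - h12
  refine ⟨x, y, z, ⟨by linear_combination h1, h2, ?_⟩, hx.1, hxd, hyd, hyd', hzd, hz.2⟩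
  linear_combination x * h2 - x ^ 2 * h1 + hx0

namespace IsRealFiber

variable {κ u d v x y z v' x' y' z' : ℝ}

theorem neg (h : IsRealFiber κ u d v x y z) : IsRealFiber κ u d (-v) (-z) (-y) (-x) := by
  obtain ⟨⟨h1, h2, h3⟩, a1, a2, a3, a4, a5, a6⟩ := h
  refine ⟨⟨?_, ?_, ?_⟩, ?_, ?_, ?_, ?_, ?_, ?_⟩
  · linear_combination -h1
  · linear_combination h2
  · linear_combination -h3
  all_goals linarith

theorem left_mem (hd : 0 < d) (h : IsRealFiber κ u d v x y z) : x ∈ Set.Icc (-1 : ℝ) 1 :=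
  ⟨h.left_ge, by linarith [h.left_lt]⟩

theorem mid_mem (h : IsRealFiber κ u d v x y z) : y ∈ Set.Icc (-1 : ℝ) 1 :=
  ⟨by linarith [h.left_ge, h.left_lt, h.mid_gt], by linarith [h.right_le, h.right_gt, h.mid_lt]⟩

theorem right_mem (hd : 0 < d) (h : IsRealFiber κ u d v x y z) : z ∈ Set.Icc (-1 : ℝ) 1 :=
  ⟨by linarith [h.right_gt], h.right_le⟩

/-- At a point t over v, the cubic of v' equals -(v' - v)κ(t^2 - d^2). Its sign is incompatible with
t lying beyond the corresponding root over v'. -/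
theorem mono (hκ : 0 < κ) (hd : 0 < d) (hdκ : κ * d ^ 2 = u) (h : IsRealFiber κ u d v x y z)
    (h' : IsRealFiber κ u d v' x' y' z') (hv : v ≤ v') : x ≤ x' ∧ y ≤ y' ∧ z ≤ z' := by
  have e : ∀ t, (t - x) * (t - y) * (t - z) = 0 →
      (t - x') * (t - y') * (t - z') = -((v' - v) * (κ * (t ^ 2 - d ^ 2))) := by
    intro t ht
    have h1 := h.fiber.cubic_eq t
    have h2 := h'.fiber.cubic_eq t
    linear_combination h2 - h1 + ht - (v' - v) * hdκ
  have hx := e x (by ring)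
  have hy := e y (by ring)
  have hz := e z (by ring)
  obtain ⟨-, a1, a2, a3, a4, a5, a6⟩ := h
  obtain ⟨-, b1, b2, b3, b4, b5, b6⟩ := h'
  have hvv : 0 ≤ v' - v := sub_nonneg.2 hv
  refine ⟨?_, ?_, ?_⟩ <;> by_contra! hlt
  · have h1 : 0 < (x - x') * (x - y') * (x - z') :=
      mul_pos_of_neg_of_neg (mul_neg_of_pos_of_neg (by linarith) (by linarith)) (by linarith)
    have h2 : 0 ≤ (v' - v) * (κ * (x ^ 2 - d ^ 2)) :=
      mul_nonneg hvv (mul_nonneg hκ.le (by nlinarith))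
    linarith
  · have h1 : (y - x') * (y - y') * (y - z') < 0 :=
      mul_neg_of_pos_of_neg (mul_pos (by linarith) (by linarith)) (by linarith)
    have h2 : 0 ≤ (v' - v) * (κ * (d ^ 2 - y ^ 2)) :=
      mul_nonneg hvv (mul_nonneg hκ.le (by nlinarith))
    linarith
  · have h1 : 0 < (z - x') * (z - y') * (z - z') :=
      mul_pos (mul_pos (by linarith) (by linarith)) (by linarith)
    have h2 : 0 ≤ (v' - v) * (κ * (z ^ 2 - d ^ 2)) :=
      mul_nonneg hvv (mul_nonneg hκ.le (by nlinarith))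
    linarith

theorem mid_eq (h : IsRealFiber κ u d v x y z) {t : ℝ} (ht : t ∈ Set.Ioo (-d) d)
    (hv : v * (κ * t ^ 2 - u) = t * (t ^ 2 - u)) : y = t := by
  have h1 := h.fiber.cubic_eq t
  rw [hv, sub_self] at h1
  rcases mul_eq_zero.1 h1 with h2 | h2
  · rcases mul_eq_zero.1 h2 with h3 | h3
    · linarith [h.left_lt, ht.1]
    · linarith
  · linarith [h.right_gt, ht.2]

end IsRealFiber

/-! ### Making a pole critical -/

/-- For κ = k^2 and u = k|b|^2, the numerator of φ'(b) is k b^2 times this expression, which equals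
-4(Im b)^2 at k = 1 and 12(Re b)^2 at k = 3. -/
theorem exists_critical_parameter {b : ℂ} (hb : b.im ≠ 0) :
    ∃ k : ℝ, 1 < k ∧ k ≤ 3 ∧
      k ^ 2 * ‖b‖ ^ 2 + 2 * k * (b.re ^ 2 - b.im ^ 2) - 3 * ‖b‖ ^ 2 = 0 := by
  have hn : ‖b‖ ^ 2 = b.re ^ 2 + b.im ^ 2 := by
    rw [← Complex.normSq_eq_norm_sq, Complex.normSq_apply]
    ring
  have him : 0 < b.im ^ 2 := by positivity
  set f : ℝ → ℝ := fun k =>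
    k ^ 2 * ‖b‖ ^ 2 + 2 * k * (b.re ^ 2 - b.im ^ 2) - 3 * ‖b‖ ^ 2 with hf
  have h1 : f 1 < 0 := by
    simp only [hf, hn]
    nlinarith
  have h3 : 0 ≤ f 3 := by
    simp only [hf, hn]
    nlinarith [sq_nonneg b.re]
  obtain ⟨k, hk, hk0⟩ := intermediate_value_Icc (by norm_num : (1 : ℝ) ≤ 3)
    (show ContinuousOn f _ by fun_prop) (show (0 : ℝ) ∈ Set.Icc (f 1) (f 3) from ⟨h1.le, h3⟩)
  exact ⟨k, lt_of_le_of_ne hk.1 (by rintro rfl; linarith), hk.2, hk0⟩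

open ComplexConjugate in
/-- The parameter makes `b` a critical point with nonreal critical value. -/
theorem exists_critical_fiber {b : ℂ} (hb : b.im ≠ 0) {k : ℝ} (hk : 0 < k)
    (hkb : k ^ 2 * ‖b‖ ^ 2 + 2 * k * (b.re ^ 2 - b.im ^ 2) - 3 * ‖b‖ ^ 2 = 0) :
    ∃ y v₀ : ℂ, IsFiber ((k ^ 2 : ℝ) : ℂ) ((k * ‖b‖ ^ 2 : ℝ) : ℂ) v₀ b b y ∧ v₀.im ≠ 0 := by
  have hb0 : b ≠ 0 := by
    rintro rfl
    simp at hb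
  have hbc : conj b ≠ b := fun h => hb (Complex.conj_eq_iff_im.1 h)
  have hnn : ((‖b‖ ^ 2 : ℝ) : ℂ) = b * conj b := by
    rw [Complex.mul_conj, Complex.normSq_eq_norm_sq]
  have hrr : ((2 * (b.re ^ 2 - b.im ^ 2) : ℝ) : ℂ) = b ^ 2 + conj b ^ 2 := by
    apply Complex.ext <;> simp [pow_two] <;> ring
  have hrel : (k : ℂ) ^ 2 * (b * conj b) + k * (b ^ 2 + conj b ^ 2) - 3 * (b * conj b) = 0 := by
    rw [← hnn, ← hrr]
    have := congrArg (fun r : ℝ => (r : ℂ)) hkb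
    push_cast at this ⊢
    linear_combination this
  have hk0 : (k : ℂ) ≠ 0 := by exact_mod_cast hk.ne'
  have hc0 : conj b ≠ 0 := by simpa using hb0
  have hu : ((k * ‖b‖ ^ 2 : ℝ) : ℂ) = k * (b * conj b) := by
    rw [Complex.ofReal_mul, hnn]
  have hu0 : (k : ℂ) * (b * conj b) ≠ 0 := mul_ne_zero hk0 (mul_ne_zero hb0 hc0)
  obtain ⟨y, hy'⟩ : ∃ y, 2 * b * y = -(k * (b * conj b) + b ^ 2) :=
    ⟨_, mul_div_cancel₀ _ (mul_ne_zero two_ne_zero hb0)⟩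
  obtain ⟨v₀, hv'⟩ : ∃ v₀, k * (b * conj b) * v₀ = -(b ^ 2 * y) := ⟨_, mul_div_cancel₀ _ hu0⟩
  have hfib : IsFiber ((k ^ 2 : ℝ) : ℂ) ((k * ‖b‖ ^ 2 : ℝ) : ℂ) v₀ b b y := by
    rw [hu, Complex.ofReal_pow]
    refine ⟨?_, by linear_combination hy', by linear_combination hv'⟩
    refine mul_left_cancel₀ hu0 (mul_left_cancel₀ (mul_ne_zero two_ne_zero hb0) ?_)
    linear_combination (k * (b * conj b) + k ^ 2 * b ^ 2) * hy' - 2 * b * k ^ 2 * hv' -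
      k * b ^ 2 * hrel
  -- If v₀ were real, conj b would lie in its fiber, hence be y; then 2b + conj b = κv₀ would be
  -- real, forcing b = conj b.
  refine ⟨y, v₀, hfib, fun him => hbc ?_⟩
  have hvc : conj v₀ = v₀ := Complex.conj_eq_iff_im.2 him
  have h1 := hfib.cubic_eq (conj b)
  have h2 := congrArg conj (hfib.cubic_eq b)
  simp only [map_mul, map_sub, map_pow, Complex.conj_ofReal, hvc, sub_self, zero_mul,
    map_zero] at h2
  rw [← h2] at h1
  have h3 : conj b - y = 0 := by
    simpa [sub_eq_zero, hbc] using h1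
  have h4 := hfib.1
  have h5 := congrArg conj hfib.1
  simp only [map_mul, map_add, Complex.conj_ofReal, hvc] at h5
  rw [← sub_eq_zero.1 h3] at h4 h5
  rw [Complex.conj_conj] at h5
  linear_combination h5 - h4

/-! ### Eliminating a near pole -/

theorem nonneg_of_hasDerivAt_of_nonneg_right {g : ℝ → ℝ} {a : ℝ} (hg : HasDerivAt g a 0)
    (h0 : g 0 = 0) (hpos : ∀ᶠ t in nhdsWithin 0 (Set.Ioi 0), 0 ≤ g t) : 0 ≤ a := by
  have h := (hasDerivWithinAt_iff_tendsto_slope' (s := Set.Ioi (0 : ℝ)) (by simp)).1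
    hg.hasDerivWithinAt
  refine ge_of_tendsto h ?_
  filter_upwards [hpos, self_mem_nhdsWithin] with t ht ht0
  rw [slope_def_field, h0, sub_zero, sub_zero]
  exact div_nonneg ht (le_of_lt ht0)

theorem hasDerivAt_fiber_map {κ u : ℝ} (hu : u ≠ 0) :
    HasDerivAt (fun t : ℝ => t * (t ^ 2 - u) / (κ * t ^ 2 - u)) 1 0 := by
  have h1 : HasDerivAt (fun t : ℝ => t * (t ^ 2 - u)) (-u) 0 := by
    have := (hasDerivAt_id' (0 : ℝ)).fun_mul (((hasDerivAt_id' (0 : ℝ)).fun_pow 2).sub_const u)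
    simpa using this
  have h2 : HasDerivAt (fun t : ℝ => κ * t ^ 2 - u) 0 0 := by
    have := (((hasDerivAt_id' (0 : ℝ)).fun_pow 2).const_mul κ).sub_const u
    simpa using this
  have h := h1.fun_div h2 (by simpa using hu)
  have he : (-u * (κ * 0 ^ 2 - u) - 0 * (0 ^ 2 - u) * 0) / (κ * 0 ^ 2 - u) ^ 2 = (1 : ℝ) := by
    rw [div_eq_one_iff_eq (by simpa using hu)]
    ring
  rwa [he] at h

/-- Summation over the fibers eliminates a pole near the origin. -/
theorem slope_le_of_pole_near {m : ℕ} {c : ℝ} (hc : 0 ≤ c)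
    (ih : ∀ S ∈ ratClass (2 * m), (∀ x ∈ Set.Icc (-1 : ℝ) 1, S (-x) = -S x) →
      MonotoneOn S (Set.Icc (-1) 1) → deriv S 0 ≤ c * S 1)
    {p q : ℝ[X]} (hp : p.natDegree ≤ 2 * (m + 1)) (hq : q.natDegree ≤ 2 * (m + 1)) {R : ℝ → ℝ}
    (hR : ∀ x ∈ Set.Icc (-1 : ℝ) 1, q.eval x ≠ 0 ∧ R x = p.eval x / q.eval x)
    (hodd : ∀ x ∈ Set.Icc (-1 : ℝ) 1, R (-x) = -R x) (hmono : MonotoneOn R (Set.Icc (-1) 1))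
    {a : ℝ} (ha : HasDerivAt R a 0) {b : ℂ} (hb : aeval b q = 0) (hb3 : 3 * ‖b‖ ^ 2 < 1) :
    a * (1 - 3 * ‖b‖ ^ 2) ≤ c * (9 - 3 * ‖b‖ ^ 2) * R 1 := by
  -- A real b would be a zero of `q` in [-1, 1].
  have him : b.im ≠ 0 := by
    intro h0
    have hbre : b = (b.re : ℂ) := Complex.ext rfl (by simpa using h0)
    have hn : ‖b‖ = |b.re| := by
      conv_lhs => rw [hbre]
      exact Complex.norm_real _
    have habs : b.re ^ 2 ≤ 1 := by
      rw [hn, sq_abs] at hb3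
      nlinarith [sq_nonneg b.re]
    refine (hR b.re (abs_le.1 ((sq_le_one_iff_abs_le_one _).1 habs))).1 ?_
    rw [hbre] at hb
    have h := aeval_algebraMap_apply_eq_algebraMap_eval (A := ℂ) b.re q
    rw [Complex.coe_algebraMap, hb] at h
    exact_mod_cast h.symm
  obtain ⟨k, hk1, hk3, hkb⟩ := exists_critical_parameter him
  obtain ⟨y₀, v₀, hcrit, hv₀⟩ := exists_critical_fiber him (by linarith) hkb
  have hρ : 0 < ‖b‖ ^ 2 := by
    have : b ≠ 0 := by
      rintro rfl
      simp at him
    positivity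
  set ρ := ‖b‖ ^ 2 with hρdef
  have hk0 : 0 < k := by linarith
  set κ := k ^ 2 with hκdef
  set u := k * ρ with hudef
  have hκ1 : 1 < κ := by nlinarith
  have hκ9 : κ ≤ 9 := by nlinarith
  have hu0 : 0 < u := by positivity
  have hu3 : u ≤ 3 * ρ := by nlinarith
  have hu1 : u < 1 := by linarith
  set d := √(ρ / k) with hddef
  have hd0 : 0 < d := Real.sqrt_pos.2 (by positivity)
  have hdκ : κ * d ^ 2 = u := by
    rw [hddef, Real.sq_sqrt (by positivity), hκdef, hudef]
    field_simp
  set s := (1 - u) / (κ - u) with hsdef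
  have hs0 : 0 < s := div_pos (by linarith) (by linarith)
  have hex : ∀ v ∈ Set.Icc (-s) s, ∃ x y z, IsRealFiber κ u d v x y z := fun v hv =>
    exists_isRealFiber hκ1 hu0 hu1 hd0 hdκ hv
  have hqne : ∀ v x y z, IsRealFiber κ u d v x y z →
      q.eval x ≠ 0 ∧ q.eval y ≠ 0 ∧ q.eval z ≠ 0 := fun v x y z h =>
    ⟨(hR x (h.left_mem hd0)).1, (hR y h.mid_mem).1, (hR z (h.right_mem hd0)).1⟩
  have h0mem : (0 : ℝ) ∈ Set.Icc (-s) s := ⟨by linarith, hs0.le⟩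
  have hinf : {v : ℝ | ∃ x y z : ℝ, IsFiber κ u v x y z}.Infinite := by
    refine (Set.Icc_infinite (show -s < s by linarith)).mono fun v hv => ?_
    obtain ⟨x, y, z, h⟩ := hex v hv
    exact ⟨x, y, z, h.fiber⟩
  have hne : ∃ v x y z : ℝ, IsFiber κ u v x y z ∧ q.eval x ≠ 0 ∧ q.eval y ≠ 0 ∧
      q.eval z ≠ 0 := by
    obtain ⟨x, y, z, h⟩ := hex 0 h0mem
    exact ⟨0, x, y, z, h.fiber, hqne 0 x y z h⟩
  obtain ⟨P, Q, hPd, hQd, -, hPQ⟩ := exists_fiber_sum_reduced hinf hp hq hb hcrit hv₀ hne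
  set T : ℝ → ℝ := fun v => P.eval v / Q.eval v with hT
  have hTfib : ∀ v x y z, IsRealFiber κ u d v x y z →
      Q.eval v ≠ 0 ∧ T v = R x + R y + R z := by
    intro v x y z h
    obtain ⟨hx, hy, hz⟩ := hqne v x y z h
    obtain ⟨h1, h2⟩ := hPQ v x y z h.fiber hx hy hz
    rw [(hR x (h.left_mem hd0)).2, (hR y h.mid_mem).2, (hR z (h.right_mem hd0)).2]
    exact ⟨h1, h2.symm⟩
  have hQne : ∀ v ∈ Set.Icc (-s) s, Q.eval v ≠ 0 := fun v hv =>
    let ⟨x, y, z, h⟩ := hex v hv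
    (hTfib v x y z h).1
  have hTodd : ∀ v ∈ Set.Icc (-s) s, T (-v) = -T v := by
    intro v hv
    obtain ⟨x, y, z, h⟩ := hex v hv
    rw [(hTfib _ _ _ _ h).2, (hTfib _ _ _ _ h.neg).2, hodd x (h.left_mem hd0), hodd y h.mid_mem,
      hodd z (h.right_mem hd0)]
    ring
  have hTmono : MonotoneOn T (Set.Icc (-s) s) := by
    intro v hv v' hv' hvv
    obtain ⟨x, y, z, h⟩ := hex v hv
    obtain ⟨x', y', z', h'⟩ := hex v' hv'
    obtain ⟨hx, hy, hz⟩ := h.mono (by linarith) hd0 hdκ h' hvv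
    rw [(hTfib _ _ _ _ h).2, (hTfib _ _ _ _ h').2]
    have h1 := hmono (h.left_mem hd0) (h'.left_mem hd0) hx
    have h2 := hmono h.mid_mem h'.mid_mem hy
    have h3 := hmono (h.right_mem hd0) (h'.right_mem hd0) hz
    linarith
  have hTs : T s ≤ R 1 := by
    obtain ⟨x, y, z, h⟩ := hex s ⟨by linarith, le_rfl⟩
    rw [(hTfib _ _ _ _ h).2]
    -- Here z ≤ 1, while y < d < -x gives R(x) + R(y) ≤ 0.
    have h1 := hmono (h.right_mem hd0) (by norm_num : (1 : ℝ) ∈ Set.Icc (-1 : ℝ) 1) h.right_le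
    have hx := h.left_mem hd0
    have h2 := hmono h.mid_mem (⟨by linarith [hx.2], by linarith [hx.1]⟩ : -x ∈ Set.Icc (-1 : ℝ) 1)
      (by linarith [h.mid_lt, h.left_lt])
    rw [hodd x hx] at h2
    linarith
  have hscale : ∀ x ∈ Set.Icc (-1 : ℝ) 1, s * x ∈ Set.Icc (-s) s := fun x hx =>
    ⟨by nlinarith [hx.1], by nlinarith [hx.2]⟩
  have hTd : HasDerivAt T (deriv T 0) 0 :=
    ((P.differentiable 0).div (Q.differentiable 0) (hQne 0 h0mem)).hasDerivAt
  have hcomp : HasDerivAt (fun x => T (s * x)) (deriv T 0 * s) 0 := by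
    have h1 : HasDerivAt (fun x : ℝ => s * x) s 0 := by
      simpa using (hasDerivAt_id (0 : ℝ)).const_mul s
    have h2 : HasDerivAt T (deriv T 0) (s * 0) := by rwa [mul_zero]
    exact h2.comp 0 h1
  have hih := ih (fun x => T (s * x)) ?_ ?_ ?_
  rotate_left
  · refine ⟨?_, P.comp (C s * X), Q.comp (C s * X), ?_, ?_, ?_, ?_⟩
    · exact ContinuousOn.div (by fun_prop) (by fun_prop) fun x hx => hQne _ (hscale x hx)
    · rwa [natDegree_comp, natDegree_C_mul_X _ hs0.ne', mul_one]
    · rwa [natDegree_comp, natDegree_C_mul_X _ hs0.ne', mul_one]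
    · intro h
      have := congrArg (Polynomial.eval 0) h
      simp only [eval_comp, eval_mul, eval_C, eval_X, mul_zero, eval_zero] at this
      exact hQne 0 h0mem this
    · intro x _ _
      simp only [hT, eval_comp, eval_mul, eval_C, eval_X]
  · intro x hx
    simp only [mul_neg]
    exact hTodd _ (hscale x hx)
  · intro x hx y hy hxy
    exact hTmono (hscale x hx) (hscale y hy) (mul_le_mul_of_nonneg_left hxy hs0.le)
  rw [hcomp.deriv, mul_one] at hih
  -- For small t > 0 the middle point over φ(t) is t, and the outer two have moved right from their
  -- places over 0, where their values cancel. Hence T(φ(t)) ≥ R(t); φ'(0) = 1 compares the slopes.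
  have hA : a ≤ deriv T 0 := by
    set η : ℝ → ℝ := fun t => t * (t ^ 2 - u) / (κ * t ^ 2 - u) with hη
    have hηd : HasDerivAt η 1 0 := hasDerivAt_fiber_map hu0.ne'
    have hη0 : η 0 = 0 := by simp [hη]
    have hg : HasDerivAt (fun t => T (η t) - R t) (deriv T 0 * 1 - a) 0 := by
      have h2 : HasDerivAt T (deriv T 0) (η 0) := by rwa [hη0]
      exact (h2.comp 0 hηd).sub ha
    have hR0 : R 0 = 0 := by
      have := hodd 0 (by norm_num)
      rw [neg_zero] at this
      linarith
    have hT0 : T 0 = 0 := by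
      have := hTodd 0 h0mem
      rw [neg_zero] at this
      linarith
    have h := nonneg_of_hasDerivAt_of_nonneg_right hg (by rw [hη0, hT0, hR0, sub_zero]) ?_
    · linarith
    have hηc : ∀ᶠ t in nhds 0, η t < s :=
      hηd.continuousAt.eventually (gt_mem_nhds (by rw [hη0]; exact hs0))
    filter_upwards [mem_nhdsWithin_of_mem_nhds hηc, self_mem_nhdsWithin,
      mem_nhdsWithin_of_mem_nhds (gt_mem_nhds hd0)] with t ht ht0 htd
    have ht0' : 0 < t := ht0
    have hD : κ * t ^ 2 - u < 0 := by
      rw [← hdκ]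
      nlinarith [mul_pos (sub_pos.2 htd) (add_pos hd0 ht0')]
    have hN : t ^ 2 - u < 0 := by nlinarith [sq_nonneg t]
    have hηpos : 0 ≤ η t :=
      div_nonneg_of_nonpos (mul_nonpos_of_nonneg_of_nonpos ht0'.le hN.le) hD.le
    obtain ⟨x, y, z, h⟩ := hex (η t) ⟨by linarith, ht.le⟩
    obtain ⟨x', y', z', h'⟩ := hex 0 h0mem
    have hy : y = t := h.mid_eq ⟨by linarith, htd⟩ (div_mul_cancel₀ _ hD.ne)
    have hy' : y' = 0 := h'.mid_eq ⟨by linarith, hd0⟩ (by ring)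
    obtain ⟨hx, -, hz⟩ := h'.mono (by linarith) hd0 hdκ h hηpos
    have h1 := hmono (h'.left_mem hd0) (h.left_mem hd0) hx
    have h3 := hmono (h'.right_mem hd0) (h.right_mem hd0) hz
    have h4 := (hTfib _ _ _ _ h').2
    rw [hT0, hy', hR0] at h4
    rw [(hTfib _ _ _ _ h).2, hy]
    linarith
  have hR1 : 0 ≤ R 1 := by
    have h1 := hodd 1 (by norm_num)
    have h2 := hmono (by norm_num : (-1 : ℝ) ∈ Set.Icc (-1 : ℝ) 1)
      (by norm_num : (1 : ℝ) ∈ Set.Icc (-1 : ℝ) 1) (by norm_num)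
    linarith
  have hcR : 0 ≤ c * R 1 := mul_nonneg hc hR1
  rcases le_or_gt a 0 with ha0 | ha0
  · calc a * (1 - 3 * ρ) ≤ 0 := mul_nonpos_of_nonpos_of_nonneg ha0 (by linarith)
      _ ≤ c * R 1 * (9 - 3 * ρ) := mul_nonneg hcR (by linarith)
      _ = _ := by ring
  · have hfin : a * (1 - u) ≤ c * R 1 * (κ - u) := by
      have h1 : a * s ≤ c * R 1 :=
        (mul_le_mul_of_nonneg_right hA hs0.le).trans
          (hih.trans (mul_le_mul_of_nonneg_left hTs hc))
      rwa [hsdef, mul_div_assoc', div_le_iff₀ (by linarith)] at h1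
    -- The quotient (κ - u)/(1 - u) increases in κ ≤ 9 and in u ≤ 3ρ.
    have hcross : (1 - 3 * ρ) * (κ - u) ≤ (1 - u) * (9 - 3 * ρ) := by nlinarith
    refine le_of_mul_le_mul_right ?_ (show 0 < κ - u by linarith)
    calc a * (1 - 3 * ρ) * (κ - u) = a * ((1 - 3 * ρ) * (κ - u)) := by ring
      _ ≤ a * ((1 - u) * (9 - 3 * ρ)) := mul_le_mul_of_nonneg_left hcross ha0.le
      _ = a * (1 - u) * (9 - 3 * ρ) := by ring
      _ ≤ c * R 1 * (κ - u) * (9 - 3 * ρ) := mul_le_mul_of_nonneg_right hfin (by linarith)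
      _ = _ := by ring

/-! ### Constants and the induction -/

/-- The constant in the inductive form of the slope bound. -/
noncomputable def slopeConst (n : ℕ) : ℝ := (9 ^ n - 2 ^ n) / 2

/-- Squared modulus separating near poles from far poles. -/
noncomputable def poleThreshold (m : ℕ) : ℝ := 7 * 2 ^ m / (24 * 9 ^ m - 3 * 2 ^ m)

theorem two_pow_le_nine_pow (m : ℕ) : (2 : ℝ) ^ m ≤ 9 ^ m :=
  pow_le_pow_left₀ (by norm_num) (by norm_num) m

theorem slopeConst_nonneg (n : ℕ) : 0 ≤ slopeConst n :=
  div_nonneg (sub_nonneg.2 (two_pow_le_nine_pow n)) (by norm_num)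

theorem poleThreshold_pos (m : ℕ) : 0 < poleThreshold m := by
  have h := two_pow_le_nine_pow m
  have h2 : (0 : ℝ) < 2 ^ m := by positivity
  exact div_pos (by positivity) (by linarith)

theorem three_mul_poleThreshold_le (m : ℕ) : 3 * poleThreshold m ≤ 1 := by
  have h := two_pow_le_nine_pow m
  have h2 : (0 : ℝ) < 2 ^ m := by positivity
  rw [poleThreshold, mul_div_assoc', div_le_one (by linarith)]
  linarith

/-- `poleThreshold m` is the value of r at which the two sides are equal. -/
theorem slopeConst_mul_le {m : ℕ} {r : ℝ} (hr : r < poleThreshold m) :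
    slopeConst m * (9 - 3 * r) ≤ slopeConst (m + 1) * (1 - 3 * r) := by
  have h := two_pow_le_nine_pow m
  have h2 : (0 : ℝ) < 2 ^ m := by positivity
  rw [poleThreshold, lt_div_iff₀ (by linarith)] at hr
  simp only [slopeConst, pow_succ]
  linarith

/-- With e = √w/2 the left side grows like (15/4)^m and the right like (3√2)^m, and 5/4 < √2. -/
theorem exists_scale (m : ℕ) : ∃ e : ℝ, 0 < e ∧ e ≤ 1 ∧
    3 ^ m * (1 + e ^ 2 / poleThreshold m) ^ (m + 1) ≤ e * slopeConst (m + 1) := by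
  rcases Nat.eq_zero_or_pos m with rfl | hm0
  -- For m = 0 the choice √w/2 is too small; with w = 1/3 and e = 1/2 both sides equal 7/4.
  · exact ⟨1 / 2, by norm_num, by norm_num, by norm_num [poleThreshold, slopeConst]⟩
  obtain ⟨j, hm⟩ := Nat.exists_eq_add_of_le' hm0
  have hw := poleThreshold_pos m
  have hw3 := three_mul_poleThreshold_le m
  set w := poleThreshold m with hwdef
  have hs : 0 < √w := Real.sqrt_pos.2 hw
  have hsq : √w ^ 2 = w := Real.sq_sqrt hw.le
  refine ⟨√w / 2, by positivity, by nlinarith, ?_⟩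
  have he : (√w / 2) ^ 2 / w = 1 / 4 := by
    rw [div_pow, hsq]
    field_simp
    norm_num
  rw [he]
  refine le_of_sq_le_sq ?_ (mul_nonneg (by positivity) (slopeConst_nonneg _))
  rw [mul_pow, mul_pow, div_pow, hsq, hwdef, poleThreshold, slopeConst]
  have hA : (0 : ℝ) < 9 ^ m := by positivity
  have hB : (0 : ℝ) < 2 ^ m := by positivity
  have hBA : 9 * (2 : ℝ) ^ m ≤ 2 * 9 ^ m := by
    rw [hm, pow_succ, pow_succ]
    linarith [two_pow_le_nine_pow j]
  have hC : 32 * (25 / 16 : ℝ) ^ m ≤ 25 * 2 ^ m := by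
    have : (25 / 16 : ℝ) ^ j ≤ 2 ^ j := pow_le_pow_left₀ (by norm_num) (by norm_num) j
    rw [hm, pow_succ, pow_succ]
    linarith
  have e1 : ((3 : ℝ) ^ m) ^ 2 = 9 ^ m := by
    rw [← pow_mul, mul_comm, pow_mul]; norm_num
  have e2 : ((1 + 1 / 4 : ℝ) ^ (m + 1)) ^ 2 = (25 / 16) ^ m * (25 / 16) := by
    rw [← pow_mul, mul_comm, pow_mul, pow_succ]; norm_num
  rw [e1, e2, pow_succ (9 : ℝ) m, pow_succ (2 : ℝ) m, div_div, div_mul_eq_mul_div,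
    le_div_iff₀ (by linarith)]
  generalize (9 : ℝ) ^ m = A at *
  generalize (2 : ℝ) ^ m = B at *
  generalize (25 / 16 : ℝ) ^ m = D at *
  have hlin : 77 * A ≤ 9 * (A * 9 - B * 2) := by linarith
  have hsq2 : (77 * A) ^ 2 ≤ (9 * (A * 9 - B * 2)) ^ 2 :=
    pow_le_pow_left₀ (by linarith) hlin 2
  have h1 : A * (D * (25 / 16)) * ((24 * A - 3 * B) * 2 ^ 2) ≤
      A * (25 * B / 32 * (25 / 16)) * (24 * A * 2 ^ 2) := by
    have hD : D ≤ 25 * B / 32 := by linarith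
    have h0 : 0 ≤ (24 * A - 3 * B) * 2 ^ 2 := by nlinarith
    have h0' : (24 * A - 3 * B) * 2 ^ 2 ≤ 24 * A * 2 ^ 2 := by nlinarith
    gcongr
  refine h1.trans ?_
  nlinarith [mul_le_mul_of_nonneg_left hsq2 hB.le, mul_pos (mul_pos hA hA) hB]

theorem deriv_zero_le_slopeConst (n : ℕ) : ∀ R ∈ ratClass (2 * n),
    (∀ x ∈ Set.Icc (-1 : ℝ) 1, R (-x) = -R x) → MonotoneOn R (Set.Icc (-1) 1) →
      DifferentiableAt ℝ R 0 ∧ deriv R 0 ≤ slopeConst n * R 1 := by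
  induction n with
  | zero =>
    intro R hR hodd _
    obtain ⟨p, q, hp, hq, hpq, hRpq⟩ := exists_coprime_of_mem_ratClass hR
    obtain ⟨hpo, -⟩ := parity_of_odd_on hpq (fun x hx => (hRpq x hx).1) fun x hx => by
      rw [← (hRpq x hx).2, ← (hRpq (-x) ⟨by linarith [hx.2], by linarith [hx.1]⟩).2]
      exact hodd x hx
    have h := hasDerivAt_zero_of_odd_div_even hpo (hRpq 0 (by norm_num)).1 fun x hx => (hRpq x hx).2
    -- A constant numerator has no linear term, matching c_0 = 0.
    rw [coeff_eq_zero_of_natDegree_lt (by omega), zero_div] at h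
    refine ⟨h.differentiableAt, ?_⟩
    rw [h.deriv, slopeConst]
    norm_num
  | succ m ih =>
    intro R hR hodd hmono
    obtain ⟨p, q, hp, hq, hpq, hRpq⟩ := exists_coprime_of_mem_ratClass hR
    obtain ⟨hpo, hqe⟩ := parity_of_odd_on hpq (fun x hx => (hRpq x hx).1) fun x hx => by
      rw [← (hRpq x hx).2, ← (hRpq (-x) ⟨by linarith [hx.2], by linarith [hx.1]⟩).2]
      exact hodd x hx
    have hq0 := (hRpq 0 (by norm_num)).1
    have h := hasDerivAt_zero_of_odd_div_even hpo hq0 fun x hx => (hRpq x hx).2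
    refine ⟨h.differentiableAt, ?_⟩
    rw [h.deriv]
    have h1 : (1 : ℝ) ∈ Set.Icc (-1 : ℝ) 1 := by norm_num
    have h1' : (-1 : ℝ) ∈ Set.Icc (-1 : ℝ) 1 := by norm_num
    have hR1 : 0 ≤ R 1 := by
      have := hmono h1' h1 (by norm_num)
      rw [hodd 1 h1] at this
      linarith
    by_cases hnear : ∃ b : ℂ, aeval b q = 0 ∧ ‖b‖ ^ 2 < poleThreshold m
    · obtain ⟨b, hb, hbw⟩ := hnear
      have h3 : 3 * ‖b‖ ^ 2 < 1 := by linarith [three_mul_poleThreshold_le m]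
      have hstep := slope_le_of_pole_near (slopeConst_nonneg m)
        (fun S hS h₁ h₂ => (ih S hS h₁ h₂).2) hp hq hRpq hodd hmono h hb h3
      refine le_of_mul_le_mul_right (hstep.trans ?_) (sub_pos.2 h3)
      calc _ ≤ slopeConst (m + 1) * (1 - 3 * ‖b‖ ^ 2) * R 1 :=
            mul_le_mul_of_nonneg_right (slopeConst_mul_le hbw) hR1
        _ = _ := by ring
    · push Not at hnear
      obtain ⟨e, he0, he1, he⟩ := exists_scale m
      have hM : ∀ x ∈ Set.Icc (-1 : ℝ) 1, |p.eval x| ≤ R 1 * |q.eval x| := by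
        intro x hx
        obtain ⟨hqx, hx'⟩ := hRpq x hx
        have hle := hmono hx h1 hx.2
        have hge := hmono h1' hx hx.1
        rw [hodd 1 h1] at hge
        have : |R x| ≤ R 1 := abs_le.2 ⟨hge, hle⟩
        rwa [hx', abs_div, div_le_iff₀ (abs_pos.2 hqx)] at this
      have hfar := abs_coeff_one_le_of_roots_far hpo hp hqe hq (poleThreshold_pos m) hnear he0 he1
        hM hR1
      have hqpos := abs_pos.2 hq0
      refine (le_abs_self _).trans ?_
      rw [abs_div, div_le_iff₀ hqpos]
      refine le_of_mul_le_mul_left (hfar.trans ?_) he0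
      calc _ ≤ e * slopeConst (m + 1) * (R 1 * |q.eval 0|) :=
            mul_le_mul_of_nonneg_right he (mul_nonneg hR1 hqpos.le)
        _ = _ := by ring

theorem theorem1 (n : ℕ) (R : ℝ → ℝ) (hR : R ∈ ratClass (2 * n))
    (hodd : ∀ x ∈ Set.Icc (-1 : ℝ) 1, R (-x) = -R x)
    (hmono : MonotoneOn R (Set.Icc (-1) 1)) :
    DifferentiableAt ℝ R 0 ∧ deriv R 0 ≤ 1 / 2 * 9 ^ n * R 1 := by
  obtain ⟨hd, hle⟩ := deriv_zero_le_slopeConst n R hR hodd hmono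
  refine ⟨hd, hle.trans (mul_le_mul_of_nonneg_right ?_ ?_)⟩
  · have : (0 : ℝ) < 2 ^ n := by positivity
    rw [slopeConst]
    linarith
  · have h1 := hodd 1 (by norm_num)
    have h2 := hmono (by norm_num : (-1 : ℝ) ∈ Set.Icc (-1 : ℝ) 1)
      (by norm_num : (1 : ℝ) ∈ Set.Icc (-1 : ℝ) 1) (by norm_num)
    linarith
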